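/- Let $\mathbb K$ be an algebraically closed field of characteristic zero. Let $n_0\ge 0$, $n_1,n_2\ge 1$ be integers, let $l_{ij}$ ($i\in\{0,1,2\}$, $1\le j\le n_i$) be positive integers, and let $$X=\Big\{\,T_{01}^{l_{01}}\cdots T_{0n_0}^{l_{0n_0}}+T_{11}^{l_{11}}\cdots T_{1n_1}^{l_{1n_1}}+T_{21}^{l_{21}}\cdots T_{2n_2}^{l_{2n_2}}=0\,\Big\}\subset\mathbb K^{\,n_0+n_1+n_2}$$ be the corresponding trinomial hypersurface, where the first monomial is understood to be $1$ if $n_0=0$. Let $\mathrm{Aut}_{alg}(X)$ be the subgroup of the group $\mathrm{Aut}(X)$ of regular automorphisms of $X$ generated by all connected algebraic subgroups of $\mathrm{Aut}(X)$. If $X$ is not rigid, that is, if the algebra $\mathbb K[X]$ of regular functions admits a nonzero locally nilpotent $\mathbb K$-derivation, then the number of $\mathrm{Aut}_{alg}(X)$-orbits on $X$ is finite. -/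

import Mathlib

open scoped TensorProduct

universe u v

section AffineVarieties

variable (K : Type u) [Field K] (A : Type v) [CommRing A] [Algebra K A]

/-- A derivation `D` is locally nilpotent if every element is killed by some power of `D`. -/
def IsLND {K : Type u} [Field K] {A : Type v} [CommRing A] [Algebra K A]
    (D : Derivation K A A) : Prop :=
  ∀ a : A, ∃ m : ℕ, (⇑D)^[m] a = 0

/-- The affine variety with algebra of regular functions `A` is rigid if `A` admits no
nonzero locally nilpotent derivation. -/
def IsRigid : Prop :=
  ∀ D : Derivation K A A, IsLND D → D = 0

/-- A regular action of the affine group with commutative Hopf algebra `H` on the affine variety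
with algebra of regular functions `A`, given by the induced rational representation on `A` by
algebra automorphisms, that is, by a coaction `A → A ⊗ H` which is an algebra homomorphism. -/
structure RegularAction (H : Type u) [CommRing H] [HopfAlgebra K H] where
  coact : A →ₐ[K] A ⊗[K] H
  coassoc : (Algebra.TensorProduct.assoc K K K A H H).toAlgHom.comp
      ((Algebra.TensorProduct.map coact (AlgHom.id K H)).comp coact) =
    (Algebra.TensorProduct.map (AlgHom.id K A) (Bialgebra.comulAlgHom K H)).comp coact
  counit : (Algebra.TensorProduct.rid K K A).toAlgHom.comp
      ((Algebra.TensorProduct.map (AlgHom.id K A) (Bialgebra.counitAlgHom K H)).comp coact) =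
    AlgHom.id K A

variable {K A} in
/-- The endomorphism of `A` by which a `K`-point `g` of the group acts: if the coaction sends `a`
to `∑ aᵢ ⊗ hᵢ`, then `g` sends `a` to `∑ hᵢ(g) aᵢ`. -/
noncomputable def RegularAction.act {H : Type u} [CommRing H] [HopfAlgebra K H]
    (ρ : RegularAction K A H) (g : H →ₐ[K] K) : A →ₐ[K] A :=
  (Algebra.TensorProduct.rid K K A).toAlgHom.comp
    ((Algebra.TensorProduct.map (AlgHom.id K A) g).comp ρ.coact)

/-- `Γ` is a connected algebraic subgroup of the automorphism group: there is a connected affine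
algebraic group `G` (finitely generated reduced commutative Hopf algebra `H` with connected
spectrum) with a regular action on the variety, such that `Γ` is the set of automorphisms by
which the `K`-points of `G` act. (Dividing `G` by the kernel of the action, one may take the
action to be faithful, so that `Γ` is `G(K)`.) -/
def IsConnectedAlgebraicSubgroup (Γ : Subgroup (A ≃ₐ[K] A)) : Prop :=
  ∃ (H : Type u) (_ : CommRing H) (_ : HopfAlgebra K H) (ρ : RegularAction K A H),
    Algebra.FiniteType K H ∧ IsReduced H ∧ ConnectedSpace (PrimeSpectrum H) ∧
      ∀ σ : A ≃ₐ[K] A, σ ∈ Γ ↔ ∃ g : H →ₐ[K] K, (σ : A →ₐ[K] A) = ρ.act g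

/-- The subgroup of the automorphism group generated by all connected algebraic subgroups. -/
def AutAlg : Subgroup (A ≃ₐ[K] A) :=
  sSup {Γ | IsConnectedAlgebraicSubgroup K A Γ}

end AffineVarieties

section TrinomialHypersurfaces

variable (K : Type u) [Field K] {n : Fin 3 → ℕ} (l : (i : Fin 3) → Fin (n i) → ℕ)

/-- The polynomial `T₀^l₀ + T₁^l₁ + T₂^l₂` in the variables `T i j`, where `Tᵢ^lᵢ` is the product
of the `T i j ^ l i j` over `j` (which is `1` if `n i = 0`). -/
noncomputable def trinomial : MvPolynomial (Σ i : Fin 3, Fin (n i)) K :=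
  ∑ i : Fin 3, ∏ j : Fin (n i), MvPolynomial.X ⟨i, j⟩ ^ l i j

/-- The trinomial hypersurface, as a set of points of affine space. -/
def TrinomialHypersurface : Set ((Σ i : Fin 3, Fin (n i)) → K) :=
  {x | MvPolynomial.eval x (trinomial K l) = 0}

/-- The algebra of regular functions on the trinomial hypersurface. -/
abbrev TrinomialRing : Type u :=
  MvPolynomial (Σ i : Fin 3, Fin (n i)) K ⧸ Ideal.span {trinomial K l}

variable {K l}

/-- The value of regular functions at a point of the hypersurface. -/
noncomputable def evalAt (x : TrinomialHypersurface K l) : TrinomialRing K l →ₐ[K] K :=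
  Ideal.Quotient.liftₐ _ (MvPolynomial.aeval (x : (Σ i : Fin 3, Fin (n i)) → K)) <| by
    intro a ha
    obtain ⟨b, rfl⟩ := Ideal.mem_span_singleton'.1 ha
    have hx : MvPolynomial.eval (x : (Σ i : Fin 3, Fin (n i)) → K) (trinomial K l) = 0 := x.2
    rw [map_mul, MvPolynomial.aeval_eq_eval]
    simp [hx]

/-- The point of the hypersurface with coordinates `φ (T i j)`, for a homomorphism `φ` from the
algebra of regular functions to the field. -/
noncomputable def pointOfHom (φ : TrinomialRing K l →ₐ[K] K) : TrinomialHypersurface K l :=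
  ⟨fun s => φ (Ideal.Quotient.mk _ (MvPolynomial.X s)), by
    have h : (φ.comp (Ideal.Quotient.mkₐ K (Ideal.span {trinomial K l}))) =
        MvPolynomial.aeval (fun s => φ (Ideal.Quotient.mk _ (MvPolynomial.X s))) := by
      ext s; simp
    have h2 := DFunLike.congr_fun h (trinomial K l)
    rw [MvPolynomial.aeval_eq_eval] at h2
    change MvPolynomial.eval _ (trinomial K l) = 0
    refine Eq.trans h2.symm ?_
    have : Ideal.Quotient.mkₐ K (Ideal.span {trinomial K l}) (trinomial K l) = 0 :=
      Ideal.Quotient.eq_zero_iff_mem.2 (Ideal.mem_span_singleton_self _)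
    rw [AlgHom.comp_apply, this, map_zero]⟩

theorem evalAt_pointOfHom (φ : TrinomialRing K l →ₐ[K] K) : evalAt (pointOfHom φ) = φ := by
  apply Ideal.Quotient.algHom_ext
  ext s
  simp [pointOfHom, evalAt]

theorem pointOfHom_evalAt (x : TrinomialHypersurface K l) : pointOfHom (evalAt x) = x := by
  apply Subtype.ext
  funext s
  simp [pointOfHom, evalAt]

/-- The natural action of automorphisms on points: `σ • x` is the point with
`f (σ • x) = (σ⁻¹ f) (x)` for every regular function `f`. -/
noncomputable instance instMulActionTrinomialHypersurface :
    MulAction (TrinomialRing K l ≃ₐ[K] TrinomialRing K l) (TrinomialHypersurface K l) where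
  smul σ x := pointOfHom ((evalAt x).comp (σ⁻¹ : TrinomialRing K l ≃ₐ[K] TrinomialRing K l))
  one_smul x := pointOfHom_evalAt x
  mul_smul σ τ x := by
    change pointOfHom _ = pointOfHom ((evalAt (pointOfHom _)).comp _)
    rw [evalAt_pointOfHom, mul_inv_rev]
    rfl

theorem evalAt_smul (σ : TrinomialRing K l ≃ₐ[K] TrinomialRing K l)
    (x : TrinomialHypersurface K l) (f : TrinomialRing K l) :
    evalAt (σ • x) f = evalAt x (σ⁻¹ f) :=
  DFunLike.congr_fun (evalAt_pointOfHom _) f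

end TrinomialHypersurfaces

/-! One-parameter groups that scale the coordinates and multiply all three monomials by a common
factor lie in `AutAlg`. Products of such scalings can be prescribed on all coordinates except two
from different blocks (`exists_isTorusScaling_off_pair`). They move any point with a zero coordinate
to a point whose coordinates are 0, 1 or roots of -1, so such points lie in finitely many orbits
(`exists_finite_forall_smul_apply_mem`).

A point with no zero coordinate is scaled onto the curve where all coordinates but one of block 1
and one of block 2 agree with a fixed point `y`. A nonzero locally nilpotent `D` has `D T ≠ 0` for
some coordinate `T`. If `D T` does not vanish at `x`, then `T` at the images of `x` under
exponentials of multiples `cD` is a nonconstant polynomial in `c`, and a root of it gives a point of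
the orbit with a zero coordinate (`IsLND.exists_mem_autAlg_smul_apply_eq_zero`).

It remains to see that `D T` vanishes at finitely many points of the curve. The trinomial is
irreducible in its block 2 variable by Eisenstein's criterion at a simple prime factor of the sum of
the other two monomials. Eliminating that variable yields `r ≠ 0` such that `D T` has no zero on the
hypersurface where `r` has none (`exists_ne_zero_forall_eval_ne_zero`). With `r` nonzero at `y`,
only finitely many values of the block 1 coordinate are bad, and each leaves finitely many points.
-/

/-! ### Points of a group acting through a coaction. -/

section RegularActions

variable {K : Type u} [Field K] {A : Type v} [CommRing A] [Algebra K A]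
  {H : Type u} [CommRing H] [HopfAlgebra K H]

theorem RegularAction.act_apply_of_coact_eq_sum (ρ : RegularAction K A H) (g : H →ₐ[K] K)
    {ι : Type*} (s : Finset ι) (a : ι → A) (h : ι → H) {f : A}
    (hf : ρ.coact f = ∑ i ∈ s, a i ⊗ₜ h i) :
    ρ.act g f = ∑ i ∈ s, g (h i) • a i := by
  simp [RegularAction.act, hf]

/-- The convolution product is the group law on points, so this is coassociativity evaluated at the
pair `(g, h)`. -/
theorem RegularAction.act_convMul (ρ : RegularAction K A H) (g h : WithConv (H →ₐ[K] K)) :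
    ρ.act (g * h).ofConv = (ρ.act g.ofConv).comp (ρ.act h.ofConv) := by
  have e1 : (Algebra.TensorProduct.rid K K A).toAlgHom.comp
      ((Algebra.TensorProduct.map (AlgHom.id K A) g.ofConv).comp
        (ρ.coact.comp ((Algebra.TensorProduct.rid K K A).toAlgHom.comp
          (Algebra.TensorProduct.map (AlgHom.id K A) h.ofConv)))) =
      ((Algebra.TensorProduct.rid K K A).toAlgHom.comp
        (Algebra.TensorProduct.map (AlgHom.id K A)
          ((Algebra.TensorProduct.lmul' K).comp
            (Algebra.TensorProduct.map g.ofConv h.ofConv)))).comp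
      ((Algebra.TensorProduct.assoc K K K A H H).toAlgHom.comp
        (Algebra.TensorProduct.map ρ.coact (AlgHom.id K H))) := by
    ext x
    · simp
      induction ρ.coact x using TensorProduct.induction_on with
      | zero => simp
      | tmul a b => simp
      | add a b ha hb => simp only [map_add, TensorProduct.add_tmul, ha, hb]
    · simp [Algebra.TensorProduct.one_def, Algebra.smul_def]
  have e2 := congrArg (fun φ => φ.comp ρ.coact) e1
  simp only [AlgHom.comp_assoc] at e2
  simp only [RegularAction.act, AlgHom.comp_assoc]
  rw [e2, ρ.coassoc, AlgHom.convMul_def]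
  simp only [← AlgHom.comp_assoc]
  rw [AlgHom.comp_assoc _ _ (Algebra.TensorProduct.map (AlgHom.id K A)
    (Bialgebra.comulAlgHom K H)), ← Algebra.TensorProduct.map_comp]
  simp [AlgHom.comp_assoc]

theorem RegularAction.act_convOne (ρ : RegularAction K A H) :
    ρ.act (1 : WithConv (H →ₐ[K] K)).ofConv = AlgHom.id K A := by
  rw [← ρ.counit]
  rfl

/-- The automorphism by which a `K`-point of the group acts. -/
noncomputable def RegularAction.actEquiv (ρ : RegularAction K A H) :
    WithConv (H →ₐ[K] K) →* (A ≃ₐ[K] A) where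
  toFun g := AlgEquiv.ofAlgHom (ρ.act g.ofConv) (ρ.act (g⁻¹).ofConv)
    (by rw [← ρ.act_convMul, mul_inv_cancel, ρ.act_convOne])
    (by rw [← ρ.act_convMul, inv_mul_cancel, ρ.act_convOne])
  map_one' := by
    ext x
    exact DFunLike.congr_fun ρ.act_convOne x
  map_mul' g h := by
    ext x
    exact DFunLike.congr_fun (ρ.act_convMul g h) x

theorem RegularAction.isConnectedAlgebraicSubgroup_range (ρ : RegularAction K A H)
    [Algebra.FiniteType K H] [IsDomain H] :
    IsConnectedAlgebraicSubgroup K A ρ.actEquiv.range := by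
  refine ⟨H, _, _, ρ, inferInstance, inferInstance, inferInstance, fun σ => ?_⟩
  constructor
  · rintro ⟨g, rfl⟩
    exact ⟨g.ofConv, by ext x; rfl⟩
  · rintro ⟨g, hg⟩
    exact ⟨WithConv.toConv g, by ext x; exact (DFunLike.congr_fun hg x).symm⟩

/-- The inverse appears because `σ` moves points by precomposition with `σ⁻¹`. -/
theorem RegularAction.exists_mem_autAlg (ρ : RegularAction K A H)
    [Algebra.FiniteType K H] [IsDomain H] (g : H →ₐ[K] K) :
    ∃ σ ∈ AutAlg K A, ∀ f, σ⁻¹ f = ρ.act g f := by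
  refine ⟨(ρ.actEquiv (WithConv.toConv g))⁻¹, ?_, fun f => ?_⟩
  · exact le_sSup (a := ρ.actEquiv.range) ρ.isConnectedAlgebraicSubgroup_range
      (inv_mem ⟨_, rfl⟩)
  · rw [inv_inv]
    rfl

end RegularActions

/-! ### The Hopf algebra of the additive group. -/

section AdditiveGroup

/-- The coordinate ring `K[t]` of the additive group. -/
def AdditiveGroupRing (K : Type u) [Field K] : Type u := Polynomial K

namespace AdditiveGroupRing

variable (K : Type u) [Field K]

noncomputable instance : CommRing (AdditiveGroupRing K) :=
  inferInstanceAs (CommRing (Polynomial K))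

noncomputable instance : Algebra K (AdditiveGroupRing K) :=
  inferInstanceAs (Algebra K (Polynomial K))

instance : IsDomain (AdditiveGroupRing K) :=
  inferInstanceAs (IsDomain (Polynomial K))

instance : Algebra.FiniteType K (AdditiveGroupRing K) :=
  inferInstanceAs (Algebra.FiniteType K (Polynomial K))

/-- The coordinate on the additive group. -/
noncomputable def t : AdditiveGroupRing K := (Polynomial.X : Polynomial K)

variable {K} in
/-- The homomorphism sending the coordinate to a given element. -/
noncomputable def lift {B : Type*} [CommRing B] [Algebra K B] (b : B) :
    AdditiveGroupRing K →ₐ[K] B :=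
  (Polynomial.aeval b : Polynomial K →ₐ[K] B)

@[simp]
theorem lift_t {B : Type*} [CommRing B] [Algebra K B] (b : B) : lift b (t K) = b :=
  Polynomial.aeval_X b

variable {K} in
@[ext]
theorem algHom_ext {B : Type*} [CommRing B] [Algebra K B] {φ ψ : AdditiveGroupRing K →ₐ[K] B}
    (h : φ (t K) = ψ (t K)) : φ = ψ :=
  Polynomial.algHom_ext (f := (φ : Polynomial K →ₐ[K] B)) (g := (ψ : Polynomial K →ₐ[K] B)) h

noncomputable instance : Bialgebra K (AdditiveGroupRing K) :=
  .ofAlgHom (lift (t K ⊗ₜ 1 + 1 ⊗ₜ t K)) (lift 0)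
    (by
      ext
      simp [Algebra.TensorProduct.one_def, TensorProduct.add_tmul, TensorProduct.tmul_add]
      abel)
    (by ext; simp) (by ext; simp)

@[simp]
theorem comul_t :
    Bialgebra.comulAlgHom K (AdditiveGroupRing K) (t K) = t K ⊗ₜ 1 + 1 ⊗ₜ t K :=
  lift_t K _

@[simp]
theorem counit_t : Bialgebra.counitAlgHom K (AdditiveGroupRing K) (t K) = 0 :=
  lift_t K _

@[simp]
theorem coalgebra_counit_t : Coalgebra.counit (R := K) (t K) = 0 :=
  counit_t K

variable {K} in
theorem tensorLift_comul_t {B : Type*} [CommRing B] [Algebra K B]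
    (φ ψ : AdditiveGroupRing K →ₐ[K] B) (h : ∀ x y, Commute (φ x) (ψ y)) :
    Algebra.TensorProduct.lift φ ψ h
      (Bialgebra.comulAlgHom K (AdditiveGroupRing K) (t K)) = φ (t K) + ψ (t K) := by
  rw [comul_t, map_add, Algebra.TensorProduct.lift_tmul, Algebra.TensorProduct.lift_tmul]
  simp

noncomputable instance : HopfAlgebra K (AdditiveGroupRing K) :=
  .ofAlgHom (lift (-t K))
    (by
      ext
      refine (tensorLift_comul_t _ _ fun _ _ => Commute.all _ _).trans ?_
      rw [AlgHom.comp_apply, counit_t]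
      simp)
    (by
      ext
      refine (tensorLift_comul_t _ _ fun _ _ => Commute.all _ _).trans ?_
      rw [AlgHom.comp_apply, counit_t]
      simp)

end AdditiveGroupRing

end AdditiveGroup

/-! ### Exponentials of locally nilpotent derivations. -/

section Exponential

variable {K : Type u} [Field K] {A : Type v} [CommRing A] [Algebra K A]

theorem Derivation.iterate_apply_mul (D : Derivation K A A) (m : ℕ) (a b : A) :
    D^[m] (a * b) = ∑ p ∈ Finset.HasAntidiagonal.antidiagonal m, m.choose p.1 • (D^[p.1] a * D^[p.2] b) := by
  induction m with
  | zero => simp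
  | succ m ih =>
    rw [Finset.sum_antidiagonal_choose_succ_nsmul (fun i j => D^[i] a * D^[j] b),
      Function.iterate_succ_apply', ih, map_sum, ← Finset.sum_add_distrib]
    refine Finset.sum_congr rfl fun p hp => ?_
    rw [map_nsmul, D.leibniz, smul_eq_mul, smul_eq_mul, nsmul_add, mul_comm (D^[p.2] b),
      ← Function.iterate_succ_apply' D, ← Function.iterate_succ_apply' D,
      Nat.choose_symm_of_eq_add (Finset.HasAntidiagonal.mem_antidiagonal.1 hp).symm]

theorem Derivation.iterate_apply_eq_zero_of_le (D : Derivation K A A) {a : A} {m k : ℕ}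
    (h : D^[m] a = 0) (hmk : m ≤ k) : D^[k] a = 0 := by
  obtain ⟨j, rfl⟩ := Nat.exists_eq_add_of_le' hmk
  rw [Function.iterate_add_apply, h]
  exact Function.iterate_fixed (map_zero D) j

theorem Derivation.iterate_apply_smul (D : Derivation K A A) (m : ℕ) (c : K) (a : A) :
    D^[m] (c • a) = c • D^[m] a := by
  induction m with
  | zero => rfl
  | succ m ih => rw [Function.iterate_succ_apply', ih, map_smul, Function.iterate_succ_apply']

/-- The divided power `D ^ m / m!` of a derivation. -/
noncomputable def Derivation.divPow (D : Derivation K A A) (m : ℕ) (a : A) : A :=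
  ((m.factorial : K)⁻¹) • D^[m] a

theorem Derivation.divPow_zero (D : Derivation K A A) (a : A) : D.divPow 0 a = a := by
  simp [Derivation.divPow]

theorem Derivation.divPow_one (D : Derivation K A A) (a : A) : D.divPow 1 a = D a := by
  simp [Derivation.divPow]

theorem Derivation.divPow_eq_zero (D : Derivation K A A) {a : A} {m k : ℕ}
    (h : D^[m] a = 0) (hmk : m ≤ k) : D.divPow k a = 0 := by
  rw [Derivation.divPow, D.iterate_apply_eq_zero_of_le h hmk, smul_zero]

theorem Derivation.divPow_add (D : Derivation K A A) (m : ℕ) (a b : A) :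
    D.divPow m (a + b) = D.divPow m a + D.divPow m b := by
  simp only [Derivation.divPow, ← smul_add, ← Module.End.pow_apply D.toLinearMap m, map_add,
    ← Derivation.coeFn_coe]

theorem Derivation.divPow_algebraMap (D : Derivation K A A) (m : ℕ) (c : K) :
    D.divPow m (algebraMap K A c) = if m = 0 then algebraMap K A c else 0 := by
  cases m with
  | zero => simp [D.divPow_zero]
  | succ m =>
    rw [D.divPow_eq_zero (m := 1) (by simp) (by omega)]
    simp

variable [CharZero K]

/-- Dividing by `m!` absorbs the binomial coefficients of the Leibniz rule; this makes the
exponential multiplicative. -/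
theorem Derivation.divPow_mul (D : Derivation K A A) (m : ℕ) (a b : A) :
    D.divPow m (a * b) = ∑ p ∈ Finset.HasAntidiagonal.antidiagonal m, D.divPow p.1 a * D.divPow p.2 b := by
  rw [Derivation.divPow, D.iterate_apply_mul, Finset.smul_sum]
  refine Finset.sum_congr rfl fun p hp => ?_
  rw [Derivation.divPow, Derivation.divPow, smul_mul_smul_comm, ← Nat.cast_smul_eq_nsmul K,
    smul_smul, ← (Finset.HasAntidiagonal.mem_antidiagonal.1 hp), Nat.cast_add_choose K]
  congr 1
  have h1 := fun n : ℕ => (Nat.cast_ne_zero (R := K)).2 n.factorial_ne_zero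
  field_simp [h1]

theorem Derivation.divPow_divPow (D : Derivation K A A) (i j : ℕ) (a : A) :
    D.divPow i (D.divPow j a) = (i + j).choose i • D.divPow (i + j) a := by
  have h1 := fun n : ℕ => (Nat.cast_ne_zero (R := K)).2 n.factorial_ne_zero
  rw [Derivation.divPow, Derivation.divPow, Derivation.divPow, D.iterate_apply_smul, smul_smul,
    ← Function.iterate_add_apply, ← Nat.cast_smul_eq_nsmul K, smul_smul, Nat.cast_add_choose K]
  congr 1
  field_simp [h1]

/-- The exponential `a ↦ ∑ tᵐ Dᵐ(a) / m!` of a locally nilpotent derivation. -/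
noncomputable def IsLND.expPolynomial {D : Derivation K A A} (hD : IsLND D) : A →ₐ[K] Polynomial A := by
  classical
  -- All coefficients are divided powers, also beyond the truncation, so the bound chosen by
  -- `Nat.find` plays no role in the axioms.
  have hc : ∀ a k, (∑ m ∈ Finset.range (Nat.find (hD a)),
      Polynomial.monomial m (D.divPow m a)).coeff k = D.divPow k a := by
    intro a k
    simp only [Polynomial.finsetSum_coeff, Polynomial.coeff_monomial, Finset.sum_ite_eq',
      Finset.mem_range]
    split_ifs with h
    · rfl
    · exact (D.divPow_eq_zero (Nat.find_spec (hD a)) (not_lt.1 h)).symm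
  exact
  { toFun := fun a => ∑ m ∈ Finset.range (Nat.find (hD a)),
      Polynomial.monomial m (D.divPow m a)
    map_one' := by
      ext k
      rw [hc, ← map_one (algebraMap K A), D.divPow_algebraMap, map_one, Polynomial.coeff_one]
    map_zero' := by
      ext k
      rw [hc, ← map_zero (algebraMap K A), D.divPow_algebraMap]
      simp
    map_mul' := fun a b => by
      ext k
      rw [Polynomial.coeff_mul, hc, D.divPow_mul]
      simp only [hc]
    map_add' := fun a b => by
      ext k
      rw [Polynomial.coeff_add, hc, hc, hc, D.divPow_add]
    commutes' := fun c => by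
      ext k
      rw [hc, D.divPow_algebraMap, IsScalarTower.algebraMap_apply K A (Polynomial A),
        Polynomial.algebraMap_eq, Polynomial.coeff_C] }

theorem IsLND.expPolynomial_eq_sum {D : Derivation K A A} (hD : IsLND D) {a : A} {N : ℕ} (hN : D^[N] a = 0) :
    hD.expPolynomial a = ∑ m ∈ Finset.range N, Polynomial.monomial m (D.divPow m a) := by
  classical
  change ∑ m ∈ Finset.range (Nat.find (hD a)), Polynomial.monomial m (D.divPow m a) = _
  refine Finset.sum_subset (Finset.range_subset_range.2 (Nat.find_min' _ hN)) fun m _ hm => ?_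
  rw [D.divPow_eq_zero (Nat.find_spec (hD a)) (by simpa using hm), map_zero]

/-- The coaction of the additive group given by the exponential of a locally nilpotent
derivation. -/
noncomputable def IsLND.coaction {D : Derivation K A A} (hD : IsLND D) :
     A →ₐ[K] A ⊗[K] AdditiveGroupRing K :=
  (polyEquivTensor K A : Polynomial A →ₐ[K] A ⊗[K] Polynomial K).comp hD.expPolynomial

theorem IsLND.coaction_eq_sum {D : Derivation K A A} (hD : IsLND D) {a : A} {N : ℕ} (hN : D^[N] a = 0) :
    hD.coaction a =
      ∑ m ∈ Finset.range N, D.divPow m a ⊗ₜ (AdditiveGroupRing.t K ^ m) := by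
  have h : ∀ m, polyEquivTensor K A (Polynomial.monomial m (D.divPow m a)) =
      D.divPow m a ⊗ₜ (Polynomial.X ^ m) := fun m => by
    rw [polyEquivTensor_apply, Polynomial.eval₂_monomial]
    simp
  change polyEquivTensor K A (hD.expPolynomial a) = _
  rw [hD.expPolynomial_eq_sum hN, map_sum]
  exact Finset.sum_congr rfl fun m _ => h m

/-- The action of the additive group by exponentials of multiples of a locally nilpotent
derivation. -/
noncomputable def IsLND.regularAction {D : Derivation K A A} (hD : IsLND D) :
    RegularAction K A (AdditiveGroupRing K) where
  coact := hD.coaction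
  coassoc := by
    ext a
    obtain ⟨N, hN⟩ := hD a
    have hN' : ∀ j, D^[N] (D.divPow j a) = 0 := fun j => by
      rw [Derivation.divPow, D.iterate_apply_smul, ← Function.iterate_add_apply,
        D.iterate_apply_eq_zero_of_le hN (Nat.le_add_right N j), smul_zero]
    have hz : ∀ i j, N ≤ i + j → D.divPow (i + j) a = 0 := fun i j h => D.divPow_eq_zero hN h
    simp only [AlgHom.comp_apply, hD.coaction_eq_sum hN, map_sum, 
      Algebra.TensorProduct.map_tmul, AlgHom.id_apply, map_pow,
      AdditiveGroupRing.comul_t]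
    have hl : ∀ i j, (Algebra.TensorProduct.assoc K K K A (AdditiveGroupRing K)
        (AdditiveGroupRing K)).toAlgHom
          ((D.divPow i (D.divPow j a) ⊗ₜ[K] (AdditiveGroupRing.t K ^ i)) ⊗ₜ[K]
            (AdditiveGroupRing.t K ^ j)) =
        (i + j).choose i • D.divPow (i + j) a ⊗ₜ[K]
          ((AdditiveGroupRing.t K ^ i) ⊗ₜ[K] (AdditiveGroupRing.t K ^ j)) := fun i j => by
      rw [D.divPow_divPow]
      rfl
    simp only [hD.coaction_eq_sum (hN' _), TensorProduct.sum_tmul, map_sum, hl]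
    have hr : ∀ m, D.divPow m a ⊗ₜ[K] ((AdditiveGroupRing.t K ⊗ₜ[K] 1 + 1 ⊗ₜ AdditiveGroupRing.t K) ^ m) = ∑ p ∈ Finset.HasAntidiagonal.antidiagonal m, (p.1 + p.2).choose p.1 • D.divPow (p.1 + p.2) a ⊗ₜ[K]
          ((AdditiveGroupRing.t K ^ p.1) ⊗ₜ[K] (AdditiveGroupRing.t K ^ p.2)) := fun m => by
      rw [(Commute.all _ _).add_pow', TensorProduct.tmul_sum]
      refine Finset.sum_congr rfl fun p hp => ?_
      rw [Finset.HasAntidiagonal.mem_antidiagonal.1 hp, TensorProduct.tmul_smul]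
      simp [Algebra.TensorProduct.tmul_pow]
    -- One side now runs over the square `i, j < N`, the other over the triangle `i + j < N`; the
    -- extra terms of the square vanish by `hz`.
    rw [Finset.sum_congr rfl fun m _ => hr m, Finset.sum_comm, ← Finset.sum_product',
      Finset.sum_sigma']
    symm
    refine Finset.sum_of_injOn (fun q => q.2) ?_ ?_ ?_ ?_
    · rintro ⟨m, p⟩ h ⟨m', p'⟩ h' rfl
      simp at h h'
      simp [← h.2, ← h'.2]
    · rintro ⟨m, p⟩ h
      simp at h ⊢
      omega
    · rintro ⟨i, j⟩ h h'
      have : N ≤ i + j := by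
        by_contra hlt
        exact h' ⟨⟨i + j, (i, j)⟩, by simp; omega, rfl⟩
      rw [hz _ _ this]
      simp
    · rintro ⟨m, p⟩ h
      rfl
  counit := by
    ext a
    obtain ⟨N, hN⟩ := hD a
    -- The bound is raised to `N + 1` so that the term `m = 0`, the only survivor, can be split off
    -- even when `N = 0`.
    simp [hD.coaction_eq_sum (D.iterate_apply_eq_zero_of_le hN (Nat.le_succ N)),
      Finset.sum_range_succ', D.divPow_zero]

theorem IsLND.exists_mem_autAlg {D : Derivation K A A} (hD : IsLND D) (c : K) :
    ∃ σ ∈ AutAlg K A, ∀ (a : A) (N : ℕ), D^[N] a = 0 →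
      σ⁻¹ a = ∑ m ∈ Finset.range N, c ^ m • D.divPow m a := by
  obtain ⟨σ, hσ, h⟩ := hD.regularAction.exists_mem_autAlg (AdditiveGroupRing.lift c)
  refine ⟨σ, hσ, fun a N hN => ?_⟩
  rw [h, hD.regularAction.act_apply_of_coact_eq_sum _ _ _ _ (hD.coaction_eq_sum hN)]
  simp

end Exponential

/-! ### Multiplicative and additive group actions on the hypersurface. -/

section TrinomialActions

variable {K : Type u} [Field K] {n : Fin 3 → ℕ} {l : (i : Fin 3) → Fin (n i) → ℕ}

variable (K l) in
/-- The coordinate function `T i j` on the trinomial hypersurface. -/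
noncomputable def trinomialCoord (s : Σ i : Fin 3, Fin (n i)) : TrinomialRing K l :=
  Ideal.Quotient.mk _ (MvPolynomial.X s)

theorem evalAt_mk (x : TrinomialHypersurface K l) (F : MvPolynomial (Σ i : Fin 3, Fin (n i)) K) :
    evalAt x (Ideal.Quotient.mk _ F) = MvPolynomial.eval x.1 F := by
  rw [← MvPolynomial.aeval_eq_eval]
  rfl

theorem evalAt_trinomialCoord (x : TrinomialHypersurface K l) (s : Σ i : Fin 3, Fin (n i)) :
    evalAt x (trinomialCoord K l s) = x.1 s := by
  rw [trinomialCoord, evalAt_mk, MvPolynomial.eval_X]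

theorem mem_trinomialHypersurface {x : (Σ i : Fin 3, Fin (n i)) → K} :
    x ∈ TrinomialHypersurface K l ↔ ∑ i, ∏ j, x ⟨i, j⟩ ^ l i j = 0 := by
  simp [TrinomialHypersurface, trinomial]

variable (K l) in
theorem map_trinomial {B F : Type*} [CommRing B]
    [FunLike F (MvPolynomial (Σ i : Fin 3, Fin (n i)) K) B]
    [RingHomClass F (MvPolynomial (Σ i : Fin 3, Fin (n i)) K) B] (φ : F) :
    φ (trinomial K l) = ∑ i, ∏ j, φ (MvPolynomial.X ⟨i, j⟩) ^ l i j := by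
  simp [trinomial]

theorem sum_prod_trinomialCoord :
    ∑ i, ∏ j, trinomialCoord K l ⟨i, j⟩ ^ l i j = 0 := by
  have h : Ideal.Quotient.mkₐ K (Ideal.span {trinomial K l}) (trinomial K l) = 0 :=
    Ideal.Quotient.eq_zero_iff_mem.2 (Ideal.mem_span_singleton_self _)
  rw [map_trinomial K l (Ideal.Quotient.mkₐ K (Ideal.span {trinomial K l}))] at h
  exact h

/-- A derivation of the algebra of regular functions which kills all coordinates is zero. -/
theorem derivation_eq_zero_of_trinomialCoord
    (D : Derivation K (TrinomialRing K l) (TrinomialRing K l))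
    (hD : ∀ s, D (trinomialCoord K l s) = 0) : D = 0 := by
  ext a
  obtain ⟨F, rfl⟩ := Ideal.Quotient.mk_surjective a
  induction F using MvPolynomial.induction_on with
  | C c => exact D.map_algebraMap c
  | add p q hp hq => rw [map_add, map_add, hp, hq]; simp
  | mul_X p s hp =>
    rw [map_mul, D.leibniz, hp]
    have := hD s
    rw [trinomialCoord] at this
    simp [this]

theorem LaurentPolynomial.comulAlgHom_T (m : ℤ) :
    Bialgebra.comulAlgHom K (LaurentPolynomial K) (LaurentPolynomial.T m) =
      LaurentPolynomial.T m ⊗ₜ LaurentPolynomial.T m :=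
  LaurentPolynomial.comul_T m

theorem LaurentPolynomial.counitAlgHom_T (m : ℤ) :
    Bialgebra.counitAlgHom K (LaurentPolynomial K) (LaurentPolynomial.T m) = 1 :=
  LaurentPolynomial.counit_T m

theorem prod_tmul_laurentPolynomial_T {A ι : Type*} [CommRing A] [Algebra K A] (t : Finset ι)
    (a : ι → A) (v : ι → ℤ) :
    ∏ j ∈ t, (a j ⊗ₜ[K] (LaurentPolynomial.T (v j) : LaurentPolynomial K)) =
      (∏ j ∈ t, a j) ⊗ₜ LaurentPolynomial.T (∑ j ∈ t, v j) := by
  classical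
  induction t using Finset.induction_on with
  | empty => simp [Algebra.TensorProduct.one_def]
  | insert b t hb ih =>
    rw [Finset.prod_insert hb, ih, Finset.prod_insert hb, Finset.sum_insert hb,
      LaurentPolynomial.T_add, Algebra.TensorProduct.tmul_mul_tmul]

/-- The coaction of the multiplicative group on a trinomial hypersurface by which the coordinates
have weights `w`. -/
noncomputable def weightCoaction (w : (Σ i : Fin 3, Fin (n i)) → ℤ) (d : ℤ)
    (hw : ∀ i, ∑ j, w ⟨i, j⟩ * l i j = d) :
    TrinomialRing K l →ₐ[K] TrinomialRing K l ⊗[K] LaurentPolynomial K :=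
  Ideal.Quotient.liftₐ _
    (MvPolynomial.aeval fun s =>
      trinomialCoord K l s ⊗ₜ[K] (LaurentPolynomial.T (w s) : LaurentPolynomial K)) <| by
    intro a ha
    obtain ⟨b, rfl⟩ := Ideal.mem_span_singleton'.1 ha
    -- All three monomials acquire the same factor `T d`, so the relation is preserved.
    have hp : ∀ i, ∏ j, (trinomialCoord K l ⟨i, j⟩ ⊗ₜ[K]
        (LaurentPolynomial.T (w ⟨i, j⟩) : LaurentPolynomial K)) ^ l i j =
          (∏ j, trinomialCoord K l ⟨i, j⟩ ^ l i j) ⊗ₜ LaurentPolynomial.T d := fun i => by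
      simp only [Algebra.TensorProduct.tmul_pow, LaurentPolynomial.T_pow]
      rw [← hw i, prod_tmul_laurentPolynomial_T]
      simp only [mul_comm]
    rw [map_mul, map_trinomial]
    simp only [MvPolynomial.aeval_X, hp]
    rw [← TensorProduct.sum_tmul, sum_prod_trinomialCoord, TensorProduct.zero_tmul]
    exact mul_zero (MvPolynomial.aeval (fun s =>
      trinomialCoord K l s ⊗ₜ[K] (LaurentPolynomial.T (w s) : LaurentPolynomial K)) b)

theorem weightCoaction_trinomialCoord (w : (Σ i : Fin 3, Fin (n i)) → ℤ) (d : ℤ)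
    (hw : ∀ i, ∑ j, w ⟨i, j⟩ * l i j = d) (s : Σ i : Fin 3, Fin (n i)) :
    weightCoaction (K := K) w d hw (trinomialCoord K l s) =
      trinomialCoord K l s ⊗ₜ LaurentPolynomial.T (w s) := by
  exact MvPolynomial.aeval_X _ s

theorem trinomialRing_algHom_ext {B : Type*} [CommRing B] [Algebra K B]
    {φ ψ : TrinomialRing K l →ₐ[K] B}
    (h : ∀ s, φ (trinomialCoord K l s) = ψ (trinomialCoord K l s)) : φ = ψ := by
  apply Ideal.Quotient.algHom_ext
  ext s
  exact h s

/-- The action of the multiplicative group on a trinomial hypersurface by which the coordinates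
have weights `w`. -/
noncomputable def weightAction (w : (Σ i : Fin 3, Fin (n i)) → ℤ) (d : ℤ)
    (hw : ∀ i, ∑ j, w ⟨i, j⟩ * l i j = d) :
    RegularAction K (TrinomialRing K l) (LaurentPolynomial K) where
  coact := weightCoaction w d hw
  coassoc := trinomialRing_algHom_ext fun s => by
    simp only [AlgHom.comp_apply, weightCoaction_trinomialCoord, Algebra.TensorProduct.map_tmul,
      AlgHom.id_apply, LaurentPolynomial.comulAlgHom_T]
    rfl
  counit := trinomialRing_algHom_ext fun s => by
    simp only [AlgHom.comp_apply, weightCoaction_trinomialCoord, Algebra.TensorProduct.map_tmul,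
      AlgHom.id_apply, LaurentPolynomial.counitAlgHom_T]
    exact one_smul K (trinomialCoord K l s)

theorem exists_mem_autAlg_smul_apply_eq_zpow_mul (w : (Σ i : Fin 3, Fin (n i)) → ℤ) (d : ℤ)
    (hw : ∀ i, ∑ j, w ⟨i, j⟩ * l i j = d) (c : Kˣ) :
    ∃ σ ∈ AutAlg K (TrinomialRing K l), ∀ (x : TrinomialHypersurface K l) s,
      (σ • x).1 s = (c : K) ^ w s * x.1 s := by
  have : IsDomain (LaurentPolynomial K) := inferInstance
  have : Algebra.FiniteType K (LaurentPolynomial K) := AddMonoidAlgebra.finiteType_of_fg K ℤ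
  -- The group point is evaluation of Laurent polynomials at `c`.
  obtain ⟨σ, hσ, h⟩ := (weightAction (K := K) w d hw).exists_mem_autAlg
    (AddMonoidAlgebra.lift K K ℤ ((Units.coeHom K).comp (zpowersHom Kˣ c)))
  refine ⟨σ, hσ, fun x s => ?_⟩
  rw [← evalAt_trinomialCoord, evalAt_smul, h,
    RegularAction.act_apply_of_coact_eq_sum _ _ {s} (trinomialCoord K l)
      (fun s => LaurentPolynomial.T (w s))
      (by rw [Finset.sum_singleton]; exact weightCoaction_trinomialCoord w d hw s),
    Finset.sum_singleton, map_smul, evalAt_trinomialCoord, LaurentPolynomial.T,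
    AddMonoidAlgebra.lift_single]
  simp

/-- Along the exponential flow the coordinate is a polynomial in the time `c` whose linear
coefficient is the value of its derivative at `x`, hence nonconstant; the flow is stopped at a root.
-/
theorem IsLND.exists_mem_autAlg_smul_apply_eq_zero [IsAlgClosed K] [CharZero K]
    {D : Derivation K (TrinomialRing K l) (TrinomialRing K l)} (hD : IsLND D)
    (x : TrinomialHypersurface K l) (s : Σ i : Fin 3, Fin (n i))
    (hx : evalAt x (D (trinomialCoord K l s)) ≠ 0) :
    ∃ σ ∈ AutAlg K (TrinomialRing K l), (σ • x).1 s = 0 := by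
  set a := trinomialCoord K l s
  obtain ⟨N, hN⟩ := hD a
  set p : Polynomial K :=
    ∑ m ∈ Finset.range N, Polynomial.monomial m (evalAt x (D.divPow m a)) with hp
  have hN1 : 1 < N := by
    by_contra h
    have h1 := D.iterate_apply_eq_zero_of_le hN (not_lt.1 h)
    exact hx (by rw [Function.iterate_one] at h1; rw [h1, map_zero])
  have hc : p.coeff 1 ≠ 0 := by
    rw [hp]
    simp only [Polynomial.finsetSum_coeff, Polynomial.coeff_monomial, Finset.sum_ite_eq',
      Finset.mem_range, if_pos hN1, D.divPow_one]
    exact hx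
  have hdeg : p.degree ≠ 0 := by
    intro h
    rw [Polynomial.eq_C_of_degree_eq_zero h, Polynomial.coeff_C] at hc
    simp at hc
  obtain ⟨c, hc⟩ := IsAlgClosed.exists_root p hdeg
  obtain ⟨σ, hσ, h⟩ := hD.exists_mem_autAlg c
  refine ⟨σ, hσ, ?_⟩
  rw [← evalAt_trinomialCoord, evalAt_smul, h _ N hN, ← hc, hp]
  simp only [map_sum, map_smul, Polynomial.eval_finsetSum, Polynomial.eval_monomial, smul_eq_mul,
    mul_comm]

end TrinomialActions

/-! ### Eisenstein's criterion and elimination of a variable. -/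

section Eisenstein

open Polynomial in
theorem Polynomial.irreducible_C_mul_X_pow_add_C {R : Type*} [CommRing R] [IsDomain R]
    [UniqueFactorizationMonoid R] {c b π : R} {q : ℕ} (hq : 0 < q) (hπ : Prime π) (hb : π ∣ b)
    (hb2 : ¬ π ^ 2 ∣ b) (h : ∀ p, Prime p → p ∣ c → ¬ p ∣ b) :
    Irreducible (C c * X ^ q + C b) := by
  have hπc : ¬ π ∣ c := fun hc => h π hπ hc hb
  have hc0 : c ≠ 0 := fun hc => hπc (hc ▸ dvd_zero π)
  have hb0 : b ≠ 0 := fun hb => hb2 (hb ▸ dvd_zero _)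
  have hlt : (C b).degree < (C c * X ^ q).degree := by
    rw [degree_C_mul_X_pow q hc0, degree_C hb0]
    exact_mod_cast hq
  have hdeg : (C c * X ^ q + C b).degree = (q : WithBot ℕ) := by
    rw [degree_add_eq_left_of_degree_lt hlt, degree_C_mul_X_pow q hc0]
  have hcoeff : ∀ k, (C c * X ^ q + C b).coeff k =
      (if k = q then c else 0) + if k = 0 then b else 0 := fun k => by
    simp [coeff_X_pow, coeff_C]
  refine irreducible_of_eisenstein_criterion (P := Ideal.span {π})
    ((Ideal.span_singleton_prime hπ.ne_zero).2 hπ) ?_ ?_ ?_ ?_ ?_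
  · rw [leadingCoeff_add_of_degree_lt' hlt, leadingCoeff_C_mul_X_pow, Ideal.mem_span_singleton]
    exact hπc
  · intro k hk
    rw [hdeg, Nat.cast_lt] at hk
    rw [hcoeff, if_neg hk.ne, zero_add, Ideal.mem_span_singleton]
    split_ifs
    · exact hb
    · exact dvd_zero π
  · rw [hdeg]
    exact_mod_cast hq
  · rw [hcoeff, if_neg hq.ne, if_pos rfl, zero_add, Ideal.span_singleton_pow,
      Ideal.mem_span_singleton]
    exact hb2
  · intro r hr
    rw [C_dvd_iff_dvd_coeff] at hr
    have hrb : r ∣ b := by simpa [hcoeff, hq.ne] using hr 0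
    have hrc : r ∣ c := by simpa [hcoeff, hq.ne'] using hr q
    by_contra hu
    obtain ⟨p, hp, hpr⟩ := WfDvdMonoid.exists_irreducible_factor hu
      (fun h0 => hb0 (zero_dvd_iff.1 (h0 ▸ hrb)))
    exact h p hp.prime (hpr.trans hrc) (hpr.trans hrb)

-- A substitute for the resultant: the class of `F` in the domain `R[X]/(p)` is nonzero and
-- algebraic over `R`, so it divides a nonzero element of `R`.
open Polynomial in
theorem Polynomial.exists_mul_add_mul_eq_C_of_prime {R : Type*} [CommRing R] [IsDomain R]
    {p F : R[X]} (hp : Prime p) (hF : ¬ p ∣ F) :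
    ∃ r : R, r ≠ 0 ∧ ∃ G H : R[X], F * G + p * H = C r := by
  have : IsDomain (AdjoinRoot p) := AdjoinRoot.isDomain_of_prime hp
  have halg : IsAlgebraic R (AdjoinRoot.mk p F) := by
    rw [← AdjoinRoot.aeval_eq]
    have hroot : IsAlgebraic R (AdjoinRoot.root p) := ⟨p, hp.ne_zero, by simp⟩
    exact Algebra.isAlgebraic_adjoin_singleton_iff.2 hroot _
      (Polynomial.aeval_mem_adjoin_singleton _ _)
  obtain ⟨r, hr, G, hG⟩ := halg.exists_nonzero_dvd
    (mem_nonZeroDivisors_of_ne_zero fun h => hF (AdjoinRoot.mk_eq_zero.1 h))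
  obtain ⟨G, rfl⟩ := AdjoinRoot.mk_surjective G
  rw [AdjoinRoot.algebraMap_eq, ← AdjoinRoot.mk_C, ← map_mul, AdjoinRoot.mk_eq_mk] at hG
  obtain ⟨H, hH⟩ := hG
  exact ⟨r, hr, G, H, by rw [← hH]; ring⟩

end Eisenstein

/-! ### Irreducibility of the trinomial and the zeros of a function on it. -/

section TrinomialIrreducible

open MvPolynomial

variable {K : Type u} [Field K] {n : Fin 3 → ℕ} {l : (i : Fin 3) → Fin (n i) → ℕ}

theorem MvPolynomial.X_dvd_of_prime_dvd_prod {σ ι : Type*} {t : Finset ι} {f : ι → σ} {k : ι → ℕ}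
    {π : MvPolynomial σ K} (hπ : Prime π) (h : π ∣ ∏ j ∈ t, X (f j) ^ k j) :
    ∃ j ∈ t, ∀ F : MvPolynomial σ K, π ∣ F → X (f j) ∣ F := by
  obtain ⟨j, hj, hd⟩ := hπ.exists_mem_finset_dvd h
  have ha : Associated π (X (f j)) :=
    hπ.associated_of_dvd (MvPolynomial.X_prime) (hπ.dvd_of_dvd_pow hd)
  exact ⟨j, hj, fun F hF => ha.symm.dvd.trans hF⟩

theorem MvPolynomial.eval_eq_zero_of_X_dvd {σ : Type*} {s : σ} {F : MvPolynomial σ K}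
    (h : X s ∣ F) {y : σ → K} (hy : y s = 0) : eval y F = 0 := by
  obtain ⟨G, rfl⟩ := h
  simp [hy]

theorem MvPolynomial.pderiv_prod_X_pow_eq_zero {σ ι : Type*} {t : Finset ι} {f : ι → σ}
    {k : ι → ℕ} {s : σ} (h : ∀ j ∈ t, f j ≠ s) :
    pderiv s (∏ j ∈ t, X (f j) ^ k j : MvPolynomial σ K) = 0 := by
  refine Finset.prod_induction _ (fun F => pderiv s F = 0) (fun F G hF hG => ?_) ?_
    fun j hj => ?_
  · rw [Derivation.leibniz, hF, hG, smul_zero, smul_zero, add_zero]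
  · simp
  · rw [Derivation.leibniz_pow, pderiv_X_of_ne (h j hj)]
    simp

/-- The operator `X s₁ * pderiv s₁` kills the first monomial and multiplies the second by an
exponent, nonzero in characteristic zero. A squared prime factor would therefore divide both
monomials, although these share no variable. -/
theorem exists_prime_dvd_not_sq_dvd_binomial [IsAlgClosed K] [CharZero K] (hn1 : 0 < n 1)
    (hl : ∀ i j, 0 < l i j) :
    ∃ π : MvPolynomial (Σ i : Fin 3, Fin (n i)) K, Prime π ∧
      π ∣ (∏ j, X ⟨0, j⟩ ^ l 0 j + ∏ j, X ⟨1, j⟩ ^ l 1 j) ∧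
      ¬ π ^ 2 ∣ (∏ j, X ⟨0, j⟩ ^ l 0 j + ∏ j, X ⟨1, j⟩ ^ l 1 j) := by
  classical
  set m₀ : MvPolynomial (Σ i : Fin 3, Fin (n i)) K := ∏ j, X ⟨0, j⟩ ^ l 0 j with hm₀
  set m₁ : MvPolynomial (Σ i : Fin 3, Fin (n i)) K := ∏ j, X ⟨1, j⟩ ^ l 1 j with hm₁
  let j₁ : Fin (n 1) := ⟨0, hn1⟩
  let s₁ : Σ i : Fin 3, Fin (n i) := ⟨1, j₁⟩
  have hsplit : m₁ = X s₁ ^ l 1 j₁ * ∏ j ∈ Finset.univ.erase j₁, X ⟨1, j⟩ ^ l 1 j :=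
    (Finset.mul_prod_erase _ _ (Finset.mem_univ j₁)).symm
  have hb0 : m₀ + m₁ ≠ 0 := fun h => by
    have := congrArg (eval fun _ => (1 : K)) h
    simp [hm₀, hm₁] at this
  have hbu : ¬ IsUnit (m₀ + m₁) := fun h => by
    -- With one coordinate equal to `ρ` and the others to 1 the binomial vanishes, so it is not a
    -- unit; this also covers an empty block 0.
    obtain ⟨ρ, hρ⟩ := IsAlgClosed.exists_pow_nat_eq (-1 : K) (hl 1 j₁)
    have hu := h.map (eval (Function.update (fun _ => (1 : K)) s₁ ρ))
    have h0 : eval (Function.update (fun _ => (1 : K)) s₁ ρ) m₀ = 1 := by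
      simp [hm₀, s₁]
    have h1 : eval (Function.update (fun _ => (1 : K)) s₁ ρ) m₁ = -1 := by
      rw [hsplit, map_mul, map_prod, Finset.prod_eq_one]
      · simp [hρ]
      · intro j hj
        have : (⟨1, j⟩ : Σ i : Fin 3, Fin (n i)) ≠ s₁ := by
          simpa [s₁] using hj
        simp [Function.update_of_ne this]
    rw [map_add, h0, h1] at hu
    simp at hu
  obtain ⟨π, hπ, hπb⟩ := WfDvdMonoid.exists_irreducible_factor hbu hb0
  refine ⟨π, hπ.prime, hπb, fun ⟨h, hh⟩ => ?_⟩
  have hd : X s₁ * pderiv s₁ (m₀ + m₁) = C (l 1 j₁ : K) * m₁ := by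
    have e0 : pderiv s₁ m₀ = 0 := pderiv_prod_X_pow_eq_zero fun j _ => by simp [s₁]
    have e1 : pderiv s₁ (∏ j ∈ Finset.univ.erase j₁,
        (X ⟨1, j⟩ : MvPolynomial (Σ i : Fin 3, Fin (n i)) K) ^ l 1 j) = 0 :=
      pderiv_prod_X_pow_eq_zero fun j hj => by simpa [s₁] using hj
    obtain ⟨k, hk⟩ := Nat.exists_eq_succ_of_ne_zero (hl 1 j₁).ne'
    rw [map_add, e0, zero_add, hsplit, Derivation.leibniz, e1, Derivation.leibniz_pow,
      pderiv_X_self, hk]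
    simp [pow_succ]
    ring
  have hdvd : π ∣ C (l 1 j₁ : K) * m₁ := by
    rw [← hd, hh, pow_two, Derivation.leibniz, Derivation.leibniz]
    exact ⟨X s₁ * (π * pderiv s₁ h + h * (2 * pderiv s₁ π)), by simp only [smul_eq_mul]; ring⟩
  have hm : π ∣ m₁ := by
    have h0 : (l 1 j₁ : K) ≠ 0 := Nat.cast_ne_zero.2 (hl 1 j₁).ne'
    have : m₁ = C (l 1 j₁ : K)⁻¹ * (C (l 1 j₁ : K) * m₁) := by
      rw [← mul_assoc, ← C_mul, inv_mul_cancel₀ h0, C_1, one_mul]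
    rw [this]
    exact hdvd.mul_left _
  obtain ⟨j, -, hj⟩ := X_dvd_of_prime_dvd_prod hπ.prime hm
  have h0 := eval_eq_zero_of_X_dvd (hj m₀ ((dvd_add_left hm).1 hπb))
    (y := Function.update (fun _ => (1 : K)) ⟨1, j⟩ 0) (by simp)
  simp [hm₀] at h0

/-- Outside a hypersurface in the remaining coordinates, a polynomial not divisible by the
trinomial has no zeros on the trinomial hypersurface. -/
theorem exists_ne_zero_forall_eval_ne_zero [IsAlgClosed K] [CharZero K] (hn1 : 0 < n 1)
    (hn2 : 0 < n 2) (hl : ∀ i j, 0 < l i j) {F : MvPolynomial (Σ i : Fin 3, Fin (n i)) K}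
    (hF : ¬ trinomial K l ∣ F) :
    ∃ r : MvPolynomial (Σ i : Fin 3, Fin (n i)) K, r ≠ 0 ∧
      ∀ y ∈ TrinomialHypersurface K l, ∀ z, (∀ s, s ≠ ⟨2, ⟨0, hn2⟩⟩ → z s = y s) →
        eval z r ≠ 0 → eval y F ≠ 0 := by
  classical
  let j₂ : Fin (n 2) := ⟨0, hn2⟩
  let s₂ : Σ i : Fin 3, Fin (n i) := ⟨2, j₂⟩
  -- The coefficient ring keeps all the variables, including `X s₂`, which `ψ` never produces in a
  -- coefficient. The price is that `r` may involve `X s₂`; hence `z` is left free at `s₂`.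
  let ψ : MvPolynomial (Σ i : Fin 3, Fin (n i)) K →ₐ[K]
      Polynomial (MvPolynomial (Σ i : Fin 3, Fin (n i)) K) :=
    aeval fun s => if s = s₂ then Polynomial.X else Polynomial.C (X s)
  have hψX : ψ (X s₂) = Polynomial.X := by simp [ψ]
  have hψC : ∀ s, s ≠ s₂ → ψ (X s) = Polynomial.C (X s) := fun s hs => by simp [ψ, hs]
  have hθ : ∀ P, Polynomial.eval (X s₂) (ψ P) = P := by
    have : ((Polynomial.aeval (X s₂) :
        Polynomial (MvPolynomial (Σ i : Fin 3, Fin (n i)) K) →ₐ[_] _).restrictScalars K).comp ψ =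
        AlgHom.id K _ := by
      ext1 s
      by_cases hs : s = s₂
      · subst hs
        simp [hψX]
      · simp [hψC s hs]
    intro P
    simpa using DFunLike.congr_fun this P
  have htri : ψ (trinomial K l) =
      Polynomial.C (∏ j ∈ Finset.univ.erase j₂, X ⟨2, j⟩ ^ l 2 j) * Polynomial.X ^ l 2 j₂ +
        Polynomial.C (∏ j, X ⟨0, j⟩ ^ l 0 j + ∏ j, X ⟨1, j⟩ ^ l 1 j) := by
    have e0 : ∀ j, ψ (X ⟨0, j⟩) = Polynomial.C (X ⟨0, j⟩) := fun j => hψC _ (by simp [s₂])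
    have e1 : ∀ j, ψ (X ⟨1, j⟩) = Polynomial.C (X ⟨1, j⟩) := fun j => hψC _ (by simp [s₂])
    have e2 : ∏ j ∈ Finset.univ.erase j₂, ψ (X ⟨2, j⟩) ^ l 2 j =
        ∏ j ∈ Finset.univ.erase j₂, Polynomial.C (X ⟨2, j⟩) ^ l 2 j :=
      Finset.prod_congr rfl fun j hj => by
        rw [hψC _ (by simpa [s₂] using hj)]
    rw [map_trinomial, Fin.sum_univ_three,
      ← Finset.mul_prod_erase _ (fun j => ψ (X ⟨2, j⟩) ^ l 2 j) (Finset.mem_univ j₂), e2]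
    simp only [e0, e1]
    rw [show (⟨2, j₂⟩ : Σ i : Fin 3, Fin (n i)) = s₂ from rfl, hψX]
    simp only [map_prod, map_pow, map_add]
    ring
  obtain ⟨π, hπ, hπb, hπb2⟩ := exists_prime_dvd_not_sq_dvd_binomial (K := K) hn1 hl
  have hirr : Irreducible (ψ (trinomial K l)) := by
    rw [htri]
    refine Polynomial.irreducible_C_mul_X_pow_add_C (hl 2 j₂) hπ hπb hπb2 fun p hp hpc hpb => ?_
    obtain ⟨j, -, hj⟩ := X_dvd_of_prime_dvd_prod hp hpc
    have h0 := eval_eq_zero_of_X_dvd (hj _ hpb)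
      (y := Function.update (fun _ => (1 : K)) ⟨2, j⟩ 0) (by simp)
    simp at h0
  have hdvd : ¬ ψ (trinomial K l) ∣ ψ F := fun ⟨G, hG⟩ => hF ⟨Polynomial.eval (X s₂) G, by
    rw [← hθ F, hG, Polynomial.eval_mul, hθ]⟩
  obtain ⟨r, hr, G, H, hGH⟩ := Polynomial.exists_mul_add_mul_eq_C_of_prime hirr.prime hdvd
  refine ⟨r, hr, fun y hy z hz hzr hyF => hzr ?_⟩
  -- Coefficients are evaluated at `z` and the variable at `y s₂`. If `F` and the trinomial both
  -- vanished at `y`, the identity `hGH` would give `r = 0` at `z`.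
  have hev : ∀ P, Polynomial.eval₂ (eval z) (y s₂) (ψ P) = eval y P := by
    have : (Polynomial.eval₂RingHom (eval z) (y s₂)).comp (ψ : _ →+* _) = eval y := by
      ext s
      · simp
      · by_cases hs : s = s₂
        · subst hs
          simp [hψX]
        · simp [hψC s hs, hz s hs]
    exact fun P => DFunLike.congr_fun this P
  have := congrArg (Polynomial.eval₂ (eval z) (y s₂)) hGH
  rw [Polynomial.eval₂_add, Polynomial.eval₂_mul, Polynomial.eval₂_mul, hev, hev, hyF,
    Polynomial.eval₂_C] at this
  rw [← this, show eval y (trinomial K l) = 0 from hy]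
  ring

end TrinomialIrreducible

/-! ### Scalings of the coordinates by a torus. -/

section TorusScalings

variable {K : Type u} [Field K] {n : Fin 3 → ℕ} {l : (i : Fin 3) → Fin (n i) → ℕ}

variable (l) in
/-- The scaling of the coordinates by the nonzero factors `r` is given by an element of
`AutAlg`. -/
def IsTorusScaling (r : (Σ i : Fin 3, Fin (n i)) → K) : Prop :=
  (∀ s, r s ≠ 0) ∧ ∃ σ ∈ AutAlg K (TrinomialRing K l),
    ∀ (x : TrinomialHypersurface K l) s, (σ • x).1 s = r s * x.1 s

theorem IsTorusScaling.one : IsTorusScaling l (1 : (Σ i : Fin 3, Fin (n i)) → K) :=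
  ⟨by simp, 1, one_mem _, by simp⟩

theorem IsTorusScaling.mul {r r' : (Σ i : Fin 3, Fin (n i)) → K} (h : IsTorusScaling l r)
    (h' : IsTorusScaling l r') : IsTorusScaling l (r * r') := by
  obtain ⟨h0, σ, hσ, h⟩ := h
  obtain ⟨h0', τ, hτ, h'⟩ := h'
  refine ⟨fun s => mul_ne_zero (h0 s) (h0' s), σ * τ, mul_mem hσ hτ, fun x s => ?_⟩
  rw [mul_smul, h, h', Pi.mul_apply, mul_assoc]

theorem IsTorusScaling.prod {ι : Type*} (t : Finset ι)
    {r : ι → (Σ i : Fin 3, Fin (n i)) → K} (h : ∀ a, IsTorusScaling l (r a)) :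
    IsTorusScaling l (∏ a ∈ t, r a) :=
  Finset.prod_induction _ (IsTorusScaling l) (fun _ _ => IsTorusScaling.mul) IsTorusScaling.one
    fun a _ => h a

theorem isTorusScaling_zpow (w : (Σ i : Fin 3, Fin (n i)) → ℤ) (d : ℤ)
    (hw : ∀ i, ∑ j, w ⟨i, j⟩ * l i j = d) {c : K} (hc : c ≠ 0) :
    IsTorusScaling l fun s => c ^ w s :=
  ⟨fun _ => zpow_ne_zero _ hc, exists_mem_autAlg_smul_apply_eq_zpow_mul w d hw (Units.mk0 c hc)⟩

theorem sum_single_mul (s : Σ i : Fin 3, Fin (n i)) (c : ℤ) (i : Fin 3) :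
    ∑ j, (Pi.single s c : (Σ i : Fin 3, Fin (n i)) → ℤ) ⟨i, j⟩ * l i j =
      if s.1 = i then c * l s.1 s.2 else 0 := by
  obtain ⟨i', j'⟩ := s
  split_ifs with h
  · subst h
    rw [Finset.sum_eq_single j']
    · simp
    · intro j _ hj
      rw [Pi.single_eq_of_ne (by simpa using hj), zero_mul]
    · simp
  · refine Finset.sum_eq_zero fun j _ => ?_
    rw [Pi.single_eq_of_ne (fun e => h (congrArg Sigma.fst e).symm), zero_mul]

variable [IsAlgClosed K]

/-- Weights `l i j'` at `j` and `-l i j` at `j'` cancel in the monomial, so the degree is 0 and the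
other blocks stay fixed; a root of `u` makes the factor at `j` exact. -/
theorem exists_isTorusScaling_of_mem_block (hl : ∀ i j, 0 < l i j) {i : Fin 3} {j j' : Fin (n i)}
    (hj : j ≠ j') {u : K} (hu : u ≠ 0) :
    ∃ r : (Σ i : Fin 3, Fin (n i)) → K, IsTorusScaling l r ∧ r ⟨i, j⟩ = u ∧
      ∀ s, s ≠ ⟨i, j⟩ → s ≠ ⟨i, j'⟩ → r s = 1 := by
  obtain ⟨c, hc⟩ := IsAlgClosed.exists_pow_nat_eq u (hl i j')
  have hc0 : c ≠ 0 := fun h => hu (by rw [← hc, h, zero_pow (hl i j').ne'])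
  let w : (Σ i : Fin 3, Fin (n i)) → ℤ :=
    Pi.single ⟨i, j⟩ (l i j' : ℤ) - Pi.single ⟨i, j'⟩ (l i j : ℤ)
  refine ⟨_, isTorusScaling_zpow w 0 (fun k => ?_) hc0, ?_, fun s hs hs' => ?_⟩
  · simp only [w, Pi.sub_apply, sub_mul, Finset.sum_sub_distrib, sum_single_mul]
    split_ifs <;> ring
  · have : (⟨i, j⟩ : Σ i : Fin 3, Fin (n i)) ≠ ⟨i, j'⟩ := by simpa using hj
    simp [w, Pi.single_eq_of_ne this, hc]
  · simp [w, Pi.single_eq_of_ne hs, Pi.single_eq_of_ne hs']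

/-- Each of the three coordinates gets the product of the exponents of the other two as weight, so
every monomial has degree the product of all three. -/
theorem exists_isTorusScaling_of_blocks (hl : ∀ i j, 0 < l i j) {a b c : Σ i : Fin 3, Fin (n i)}
    (hab : a.1 ≠ b.1) (hac : a.1 ≠ c.1) (hbc : b.1 ≠ c.1) {u : K} (hu : u ≠ 0) :
    ∃ r : (Σ i : Fin 3, Fin (n i)) → K, IsTorusScaling l r ∧ r a = u ∧
      ∀ s, s ≠ a → s ≠ b → s ≠ c → r s = 1 := by
  have hpos : 0 < l b.1 b.2 * l c.1 c.2 := Nat.mul_pos (hl _ _) (hl _ _)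
  obtain ⟨z, hz⟩ := IsAlgClosed.exists_pow_nat_eq u hpos
  have hz0 : z ≠ 0 := fun h => hu (by rw [← hz, h, zero_pow hpos.ne'])
  let w : (Σ i : Fin 3, Fin (n i)) → ℤ :=
    Pi.single a ((l b.1 b.2 * l c.1 c.2 : ℕ) : ℤ) + Pi.single b (l a.1 a.2 * l c.1 c.2 : ℤ) +
      Pi.single c (l a.1 a.2 * l b.1 b.2 : ℤ)
  refine ⟨_, isTorusScaling_zpow w (l a.1 a.2 * l b.1 b.2 * l c.1 c.2) (fun k => ?_) hz0, ?_,
    fun s hsa hsb hsc => ?_⟩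
  · simp only [w, Pi.add_apply, add_mul, Finset.sum_add_distrib, sum_single_mul]
    have hk : a.1 = k ∧ b.1 ≠ k ∧ c.1 ≠ k ∨ a.1 ≠ k ∧ b.1 = k ∧ c.1 ≠ k ∨
        a.1 ≠ k ∧ b.1 ≠ k ∧ c.1 = k := by
      omega
    push_cast
    rcases hk with ⟨h1, h2, h3⟩ | ⟨h1, h2, h3⟩ | ⟨h1, h2, h3⟩ <;>
      simp only [h1, h2, h3, if_true, if_false] <;> ring
  · have h1 : a ≠ b := fun h => hab (congrArg Sigma.fst h)
    have h2 : a ≠ c := fun h => hac (congrArg Sigma.fst h)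
    simp only [w, Pi.add_apply, Pi.single_eq_same, Pi.single_eq_of_ne h1, Pi.single_eq_of_ne h2,
      add_zero, zpow_natCast, hz]
  · simp [w, Pi.single_eq_of_ne hsa, Pi.single_eq_of_ne hsb, Pi.single_eq_of_ne hsc]

/-- Torus scalings can be prescribed outside a set of coordinates meeting every nonempty block. -/
theorem exists_isTorusScaling_off (hl : ∀ i j, 0 < l i j) (P : Set (Σ i : Fin 3, Fin (n i)))
    (hP : ∀ i (_ : Fin (n i)), ∃ j, ⟨i, j⟩ ∈ P) {u : (Σ i : Fin 3, Fin (n i)) → K}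
    (hu : ∀ s, u s ≠ 0) :
    ∃ r : (Σ i : Fin 3, Fin (n i)) → K, IsTorusScaling l r ∧ ∀ s, s ∉ P → r s = u s := by
  classical
  have h : ∀ s : Σ i : Fin 3, Fin (n i), ∃ r : (Σ i : Fin 3, Fin (n i)) → K,
      IsTorusScaling l r ∧ (s ∉ P → r s = u s) ∧ ∀ s', s' ∉ P → s' ≠ s → r s' = 1 := by
    rintro ⟨i, j⟩
    by_cases hs : ⟨i, j⟩ ∈ P
    · exact ⟨1, IsTorusScaling.one, fun h => (h hs).elim, fun _ _ _ => rfl⟩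
    · obtain ⟨j', hj'⟩ := hP i j
      obtain ⟨r, hr, h1, h2⟩ := exists_isTorusScaling_of_mem_block (K := K) hl (j := j) (j' := j')
        (fun e => hs (e ▸ hj')) (hu ⟨i, j⟩)
      exact ⟨r, hr, fun _ => h1, fun s' hs' hne => h2 s' hne fun e => hs' (e ▸ hj')⟩
  choose r hr h1 h2 using h
  refine ⟨∏ s, r s, IsTorusScaling.prod _ hr, fun s hs => ?_⟩
  rw [Finset.prod_apply, Finset.prod_eq_single s (fun s' _ hne => h2 s' s hs hne.symm) (by simp),
    h1 s hs]

/-- Torus scalings can be prescribed outside two coordinates from different blocks. -/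
theorem exists_isTorusScaling_off_pair (hl : ∀ i j, 0 < l i j) {a b : Σ i : Fin 3, Fin (n i)}
    (hab : a.1 ≠ b.1) {u : (Σ i : Fin 3, Fin (n i)) → K} (hu : ∀ s, u s ≠ 0) :
    ∃ r : (Σ i : Fin 3, Fin (n i)) → K, IsTorusScaling l r ∧
      ∀ s, s ≠ a → s ≠ b → r s = u s := by
  obtain ⟨i, hia, hib, hi⟩ : ∃ i : Fin 3, i ≠ a.1 ∧ i ≠ b.1 ∧ ∀ k, k = a.1 ∨ k = b.1 ∨ k = i := by
    generalize a.1 = p at hab ⊢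
    generalize b.1 = q at hab ⊢
    revert p q
    decide
  have hmem : ∀ P : Set (Σ i : Fin 3, Fin (n i)), a ∈ P → b ∈ P →
      (∀ _ : Fin (n i), ∃ j, ⟨i, j⟩ ∈ P) → ∀ k (_ : Fin (n k)), ∃ j, ⟨k, j⟩ ∈ P := by
    intro P ha hb hP k j
    rcases hi k with rfl | rfl | rfl
    exacts [⟨a.2, ha⟩, ⟨b.2, hb⟩, hP j]
  rcases isEmpty_or_nonempty (Fin (n i)) with he | ⟨⟨j⟩⟩
  · obtain ⟨r, hr, h⟩ := exists_isTorusScaling_off hl {a, b}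
      (hmem _ (by simp) (by simp) fun j => he.elim j) hu
    exact ⟨r, hr, fun s hsa hsb => h s (by simp [hsa, hsb])⟩
  · obtain ⟨r, hr, h⟩ := exists_isTorusScaling_off hl {a, b, ⟨i, j⟩}
      (hmem _ (by simp) (by simp) fun _ => ⟨j, by simp⟩) hu
    -- The first scaling is uncontrolled at `⟨i, j⟩`; this one corrects it there and otherwise
    -- touches only `a` and `b`.
    obtain ⟨r', hr', h1, h2⟩ := exists_isTorusScaling_of_blocks (K := K) hl (a := ⟨i, j⟩) hia hib
      hab (div_ne_zero (hu ⟨i, j⟩) (hr.1 ⟨i, j⟩))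
    refine ⟨r * r', hr.mul hr', fun s hsa hsb => ?_⟩
    rw [Pi.mul_apply]
    by_cases hs : s = ⟨i, j⟩
    · subst hs
      rw [h1, mul_div_cancel₀ _ (hr.1 _)]
    · rw [h s (by simp [hsa, hsb, hs]), h2 s hs hsa hsb, mul_one]

end TorusScalings

/-! ### Normal forms of points with a zero coordinate, and finiteness of zeros along a coordinate
line. -/

section FiniteOrbits

variable {K : Type u} [Field K] [IsAlgClosed K] {n : Fin 3 → ℕ}
  {l : (i : Fin 3) → Fin (n i) → ℕ}

omit [IsAlgClosed K] in
theorem finite_pow_eq_neg_one {k : ℕ} (hk : 0 < k) : {b : K | b ^ k = -1}.Finite := by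
  classical
  refine (Polynomial.nthRoots k (-1 : K)).toFinset.finite_toSet.subset fun b hb => ?_
  simpa [Polynomial.mem_nthRoots hk] using hb

/-- Every point with a zero coordinate can be moved to one whose coordinates lie in a fixed finite
set. -/
theorem exists_finite_forall_smul_apply_mem (hl : ∀ i j, 0 < l i j) (hn1 : 0 < n 1)
    (hn2 : 0 < n 2) :
    ∃ S : Set K, S.Finite ∧ ∀ (x : TrinomialHypersurface K l) (s₀ : Σ i : Fin 3, Fin (n i)),
      x.1 s₀ = 0 → ∃ σ ∈ AutAlg K (TrinomialRing K l), ∀ s, (σ • x).1 s ∈ S := by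
  classical
  refine ⟨{0, 1} ∪ ⋃ s : Σ i : Fin 3, Fin (n i), {b | b ^ l s.1 s.2 = -1},
    (Set.toFinite _).union (Set.finite_iUnion fun s => finite_pow_eq_neg_one (hl s.1 s.2)),
    fun x s₀ hs₀ => ?_⟩
  have hnorm : ∀ r : (Σ i : Fin 3, Fin (n i)) → K, ∀ s,
      (r s = if x.1 s = 0 then 1 else (x.1 s)⁻¹) → r s * x.1 s = 0 ∨ r s * x.1 s = 1 := by
    intro r s hr
    rw [hr]
    split_ifs with h
    · simp [h]
    · exact Or.inr (inv_mul_cancel₀ h)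
  have hu : ∀ s, (if x.1 s = 0 then 1 else (x.1 s)⁻¹ : K) ≠ 0 := fun s => by
    split_ifs with h
    · exact one_ne_zero
    · exact inv_ne_zero h
  have hsum : ∀ y : TrinomialHypersurface K l, ∑ i, ∏ j, y.1 ⟨i, j⟩ ^ l i j = 0 := fun y =>
    mem_trinomialHypersurface.1 y.2
  have hz : ∀ i, (∏ j, x.1 ⟨i, j⟩ ^ l i j = 0 ↔ ∃ j, x.1 ⟨i, j⟩ = 0) := fun i => by
    simp [Finset.prod_eq_zero_iff, (hl i _).ne']
  by_cases hall : ∀ i, ∃ j, x.1 ⟨i, j⟩ = 0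
  · obtain ⟨r, ⟨-, σ, hσ, h⟩, hr⟩ :=
      exists_isTorusScaling_off hl {s | x.1 s = 0} (fun i _ => hall i) hu
    refine ⟨σ, hσ, fun s => Or.inl ?_⟩
    rw [h]
    by_cases hs : x.1 s = 0
    · simp [hs]
    · exact hnorm r s (hr s hs)
  -- Block `i₂` must contain a coordinate to adjust, which is guaranteed only for blocks 1 and 2.
  · obtain ⟨i₁, i₂, h01, h02, h12⟩ : ∃ i₁ i₂ : Fin 3, s₀.1 ≠ i₁ ∧ s₀.1 ≠ i₂ ∧ i₁ ≠ i₂ ∧ i₂ ≠ 0 := by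
      generalize s₀.1 = p
      revert p
      decide
    obtain ⟨h12, hi₂⟩ := h12
    have huniv : (Finset.univ : Finset (Fin 3)) = {s₀.1, i₁, i₂} := by
      generalize s₀.1 = p at *
      revert p i₁ i₂
      decide
    have hsum' : ∀ f : Fin 3 → K, ∑ i, f i = f s₀.1 + f i₁ + f i₂ := fun f => by
      rw [huniv, Finset.sum_insert (by simp [h01, h02]), Finset.sum_pair h12, add_assoc]
    -- The monomial of `s₀` vanishes, so the other two sum to zero; if one were zero all three would
    -- be, against the case assumption.
    have hne : ∀ i, i ≠ s₀.1 → ∏ j, x.1 ⟨i, j⟩ ^ l i j ≠ 0 := by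
      have h0 : ∏ j, x.1 ⟨s₀.1, j⟩ ^ l s₀.1 j = 0 := (hz _).2 ⟨s₀.2, hs₀⟩
      have h := hsum x
      rw [hsum', h0, zero_add] at h
      by_contra! hc
      obtain ⟨k, hk, hk0⟩ := hc
      refine hall fun i => ?_
      have hi : ∀ i, i = s₀.1 ∨ i = i₁ ∨ i = i₂ := fun i => by
        simpa [huniv] using Finset.mem_univ i
      rw [← hz]
      rcases (hi k).resolve_left hk with rfl | rfl <;> rw [hk0] at h <;>
        rcases hi i with rfl | rfl | rfl <;> simp_all
    have hj₂ : 0 < n i₂ := by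
      rcases (by omega : i₂ = 1 ∨ i₂ = 2) with rfl | rfl
      exacts [hn1, hn2]
    let b : Σ i : Fin 3, Fin (n i) := ⟨i₂, ⟨0, hj₂⟩⟩
    obtain ⟨r, ⟨hr0, σ, hσ, h⟩, hr⟩ := exists_isTorusScaling_off_pair hl (a := s₀) (b := b) h02 hu
    have hone : ∀ s : Σ i : Fin 3, Fin (n i), s.1 ≠ s₀.1 → s ≠ b → (σ • x).1 s = 1 := by
      intro s hs hsb
      rw [h]
      refine (hnorm r s (hr s (fun e => hs (congrArg Sigma.fst e)) hsb)).resolve_left ?_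
      refine mul_ne_zero (hr0 s) fun h0 => hne s.1 hs ((hz _).2 ⟨s.2, h0⟩)
    refine ⟨σ, hσ, fun s => ?_⟩
    by_cases hs : s = s₀
    · left
      left
      rw [h, hs, hs₀, mul_zero]
    by_cases hsb : s = b
    · right
      refine Set.mem_iUnion.2 ⟨s, ?_⟩
      -- After scaling, the equation reads `0 + 1 + b ^ l = 0`, which leaves finitely many values at
      -- `b`.
      have hy := hsum (σ • x)
      rw [hsum', Finset.prod_eq_zero (Finset.mem_univ s₀.2)
        (by rw [h]; change (_ * x.1 s₀) ^ _ = 0; rw [hs₀, mul_zero, zero_pow (hl _ _).ne']),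
        Finset.prod_eq_one fun j _ => by
          rw [hone ⟨i₁, j⟩ h01.symm (fun e => h12 (congrArg Sigma.fst e)), one_pow],
        Finset.prod_eq_single b.2 (fun j _ hj => by
          rw [hone ⟨i₂, j⟩ h02.symm (by simpa [b] using hj), one_pow]) (by simp)] at hy
      rw [hsb]
      change (σ • x).1 b ^ l b.1 b.2 = -1
      linear_combination hy
    · left
      rw [h]
      exact hnorm r s (hr s hs hsb)

omit [IsAlgClosed K] in
theorem MvPolynomial.finite_eval_update_eq_zero {σ : Type*} [DecidableEq σ]
    (P : MvPolynomial σ K) (y : σ → K) (s : σ)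
    (h : ∃ a, MvPolynomial.eval (Function.update y s a) P ≠ 0) :
    {a | MvPolynomial.eval (Function.update y s a) P = 0}.Finite := by
  let p : Polynomial K :=
    MvPolynomial.aeval (fun t => if t = s then Polynomial.X else Polynomial.C (y t)) P
  have hp : ∀ a, p.eval a = MvPolynomial.eval (Function.update y s a) P := by
    intro a
    have : (Polynomial.aeval a).comp (MvPolynomial.aeval
        (fun t => if t = s then Polynomial.X else Polynomial.C (y t))) =
        MvPolynomial.aeval (R := K) (Function.update y s a) := by
      ext t
      by_cases ht : t = s
      · subst ht
        simp
      · simp [ht]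
    rw [← MvPolynomial.aeval_eq_eval, ← this]
    simp [p]
  obtain ⟨a, ha⟩ := h
  have hp0 : p ≠ 0 := fun h => ha (by rw [← hp, h, Polynomial.eval_zero])
  refine (Polynomial.finite_setOfPred_isRoot hp0).subset fun c hc => ?_
  exact (hp c).trans hc

/-- A nonzero polynomial over an infinite field has a nonzero value; this is applied to `r` times
the product of all variables. -/
theorem MvPolynomial.exists_eval_ne_zero_of_ne_zero {σ : Type*} [Fintype σ] {r : MvPolynomial σ K}
    (hr : r ≠ 0) : ∃ y : σ → K, (∀ s, y s ≠ 0) ∧ MvPolynomial.eval y r ≠ 0 := by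
  have : Infinite K := IsAlgClosed.instInfinite
  by_contra! hc
  have h0 : r * ∏ s, MvPolynomial.X s ≠ 0 :=
    mul_ne_zero hr (Finset.prod_ne_zero_iff.2 fun s _ => MvPolynomial.X_ne_zero s)
  refine h0 (MvPolynomial.funext fun y => ?_)
  rw [map_mul, map_prod, map_zero]
  by_cases hy : ∀ s, y s ≠ 0
  · rw [hc y hy, zero_mul]
  · push Not at hy
    obtain ⟨s, hs⟩ := hy
    rw [Finset.prod_eq_zero (Finset.mem_univ s) (by simpa using hs), mul_zero]

-- As a function of `b` the trinomial is `b ^ l` times a nonzero constant plus a constant, so it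
-- cannot vanish at both 0 and 1.
omit [IsAlgClosed K] in
theorem finite_trinomial_update_eq_zero (hl : ∀ i j, 0 < l i j)
    {y : (Σ i : Fin 3, Fin (n i)) → K} (s : Σ i : Fin 3, Fin (n i))
    (hy : ∀ t, t.1 = s.1 → t ≠ s → y t ≠ 0) :
    {b | MvPolynomial.eval (Function.update y s b) (trinomial K l) = 0}.Finite := by
  classical
  refine MvPolynomial.finite_eval_update_eq_zero _ y s ?_
  by_contra! hc
  obtain ⟨i, j⟩ := s
  have hsplit : ∀ b, MvPolynomial.eval (Function.update y ⟨i, j⟩ b) (trinomial K l) =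
      (b ^ l i j * ∏ k ∈ Finset.univ.erase j, y ⟨i, k⟩ ^ l i k) +
        ∑ m ∈ Finset.univ.erase i, ∏ k, y ⟨m, k⟩ ^ l m k := by
    intro b
    rw [map_trinomial, ← Finset.add_sum_erase _ _ (Finset.mem_univ i),
      ← Finset.mul_prod_erase _ _ (Finset.mem_univ j)]
    congr 1
    · congr 1
      · simp
      · refine Finset.prod_congr rfl fun k hk => ?_
        rw [MvPolynomial.eval_X, Function.update_of_ne (by simpa using hk)]
    · refine Finset.sum_congr rfl fun m hm => Finset.prod_congr rfl fun k _ => ?_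
      rw [MvPolynomial.eval_X, Function.update_of_ne]
      exact fun e => (Finset.mem_erase.1 hm).1 (congrArg Sigma.fst e)
  have h0 := hc 0
  have h1 := hc 1
  rw [hsplit, zero_pow (hl i j).ne', zero_mul, zero_add] at h0
  rw [hsplit, one_pow, one_mul, h0, add_zero, Finset.prod_eq_zero_iff] at h1
  obtain ⟨k, hk, hk0⟩ := h1
  exact hy ⟨i, k⟩ rfl (by simpa using hk) (pow_eq_zero_iff (hl i k).ne' |>.1 hk0)

end FiniteOrbits

/-! ### A finite set meeting every orbit. -/

theorem mainTheorem4 {K : Type u} [Field K] [IsAlgClosed K] [CharZero K]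
    (n : Fin 3 → ℕ) (hn1 : 0 < n 1) (hn2 : 0 < n 2)
    (l : (i : Fin 3) → Fin (n i) → ℕ) (hl : ∀ i j, 0 < l i j)
    (hX : ¬ IsRigid K (TrinomialRing K l)) :
    (Set.range fun x : TrinomialHypersurface K l =>
      MulAction.orbit (AutAlg K (TrinomialRing K l)) x).Finite := by
  classical
  obtain ⟨D, hD, hD0⟩ : ∃ D : Derivation K (TrinomialRing K l) (TrinomialRing K l),
      IsLND D ∧ D ≠ 0 := by
    simpa [IsRigid] using hX
  obtain ⟨t, ht⟩ : ∃ t, D (trinomialCoord K l t) ≠ 0 := by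
    by_contra! h
    exact hD0 (derivation_eq_zero_of_trinomialCoord D h)
  obtain ⟨F, hF⟩ := Ideal.Quotient.mk_surjective (D (trinomialCoord K l t))
  have hFdvd : ¬ trinomial K l ∣ F := fun h => ht (by
    rw [← hF]
    exact Ideal.Quotient.eq_zero_iff_mem.2 (Ideal.mem_span_singleton.2 h))
  obtain ⟨r, hr0, hr⟩ := exists_ne_zero_forall_eval_ne_zero hn1 hn2 hl hFdvd
  obtain ⟨y, hy0, hyr⟩ := MvPolynomial.exists_eval_ne_zero_of_ne_zero hr0
  let s₁ : Σ i : Fin 3, Fin (n i) := ⟨1, ⟨0, hn1⟩⟩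
  let s₂ : Σ i : Fin 3, Fin (n i) := ⟨2, ⟨0, hn2⟩⟩
  have hs12 : s₁.1 ≠ s₂.1 := by simp [s₁, s₂]
  obtain ⟨S, hS, hzero⟩ := exists_finite_forall_smul_apply_mem (K := K) hl hn1 hn2
  -- The exceptional points of the curve: the coordinate `a` at `s₁` is a zero of `r` along the line
  -- through `y`, and `b` then solves the trinomial equation.
  let E : Set ((Σ i : Fin 3, Fin (n i)) → K) :=
    ⋃ a ∈ {a | MvPolynomial.eval (Function.update y s₁ a) r = 0},
      (Function.update (Function.update y s₁ a) s₂) ''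
        {b | MvPolynomial.eval (Function.update (Function.update y s₁ a) s₂ b)
          (trinomial K l) = 0}
  have hE : E.Finite := by
    refine Set.Finite.biUnion (MvPolynomial.finite_eval_update_eq_zero r y s₁
      ⟨y s₁, by rwa [Function.update_eq_self]⟩) fun a _ => Set.Finite.image _ ?_
    refine finite_trinomial_update_eq_zero hl s₂ fun s hs hne => ?_
    rw [Function.update_of_ne fun e => hs12 ((congrArg Sigma.fst e).symm.trans hs)]
    exact hy0 s
  let W : Set (TrinomialHypersurface K l) := Subtype.val ⁻¹' (Set.univ.pi (fun _ => S) ∪ E)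
  have hW : W.Finite :=
    ((Set.Finite.pi fun _ => hS).union hE).preimage
      Subtype.val_injective.injOn
  have hzeroW : ∀ (x : TrinomialHypersurface K l) s, x.1 s = 0 →
      ∃ σ ∈ AutAlg K (TrinomialRing K l), σ • x ∈ W := fun x s hs => by
    obtain ⟨σ, hσ, h⟩ := hzero x s hs
    exact ⟨σ, hσ, Or.inl fun s _ => h s⟩
  have hmove : ∀ x : TrinomialHypersurface K l,
      ∃ σ ∈ AutAlg K (TrinomialRing K l), σ • x ∈ W := by
    intro x
    by_cases hx : ∃ s, x.1 s = 0
    · obtain ⟨s, hs⟩ := hx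
      exact hzeroW x s hs
    push Not at hx
    obtain ⟨q, ⟨-, σ, hσ, h⟩, hq⟩ := exists_isTorusScaling_off_pair (K := K) hl (a := s₁) (b := s₂)
      hs12 (u := fun s => y s / x.1 s) fun s => div_ne_zero (hy0 s) (hx s)
    have hσy : ∀ s, s ≠ s₁ → s ≠ s₂ → (σ • x).1 s = y s := fun s h1 h2 => by
      rw [h, hq s h1 h2, div_mul_cancel₀ _ (hx s)]
    have hupd : ∀ s, s ≠ s₂ → Function.update y s₁ ((σ • x).1 s₁) s = (σ • x).1 s :=
      fun s h2 => by
        by_cases h1 : s = s₁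
        · rw [h1, Function.update_self]
        · rw [Function.update_of_ne h1, hσy s h1 h2]
    -- Here `r` is evaluated with `y s₂` at `s₂` instead of the coordinate of the moved point; `hr`
    -- permits this.
    by_cases hroot : MvPolynomial.eval (Function.update y s₁ ((σ • x).1 s₁)) r = 0
    · refine ⟨σ, hσ, Or.inr (Set.mem_biUnion hroot ⟨(σ • x).1 s₂, ?_, ?_⟩)⟩
      all_goals
        have he : Function.update (Function.update y s₁ ((σ • x).1 s₁)) s₂ ((σ • x).1 s₂) =
            (σ • x).1 := by
          funext s
          by_cases h2 : s = s₂
          · rw [h2, Function.update_self]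
          · rw [Function.update_of_ne h2, hupd s h2]
      · rw [Set.mem_ofPred_eq, he]
        exact (σ • x).2
      · exact he
    · have hne := hr _ (σ • x).2 _ hupd hroot
      rw [← evalAt_mk, hF] at hne
      obtain ⟨τ, hτ, h0⟩ := hD.exists_mem_autAlg_smul_apply_eq_zero (σ • x) t hne
      obtain ⟨ρ, hρ, hW'⟩ := hzeroW _ t h0
      exact ⟨ρ * τ * σ, mul_mem (mul_mem hρ hτ) hσ, by rwa [mul_smul, mul_smul]⟩
  refine (hW.image fun x => MulAction.orbit (AutAlg K (TrinomialRing K l)) x).subset ?_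
  rintro _ ⟨x, rfl⟩
  obtain ⟨σ, hσ, h⟩ := hmove x
  exact ⟨σ • x, h, MulAction.orbit_smul (⟨σ, hσ⟩ : AutAlg K (TrinomialRing K l)) x⟩
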